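/- Let $k$ be an arbitrary field, $K$ an algebraic function field over $k$ (a finitely generated field extension of $k$), and $K^*$ a finite field extension of $K$. Let $\nu^*$ be a rank one valuation of $K^*$ that is trivial on $k$ (its value group is nontrivial and Archimedean), let $\nu=\nu^*|_K$ be its restriction to $K$, and let $V_\nu$ be the valuation ring of $\nu$. For a subring $A$ of the valuation ring of a valuation $\mu$ with values in an ordered group $\Gamma$, write $$\mathrm{gr}_\mu(A)=\bigoplus_{\gamma\in\Gamma}\{a\in A\mid \mu(a)\ge\gamma\}/\{a\in A\mid\mu(a)>\gamma\}$$ for the associated graded ring. Then there exist finitely many elements $f_1,\dots,f_n\in V_\nu$ with the following property. Let $R$ be a normal local domain with $k\subset R\subset K$ whose quotient field is $K$, which is essentially of finite type over $k$, which is dominated by $\nu$ (that is, $R\subset V_\nu$ and $m_\nu\cap R=m_R$), and which contains $f_1,\dots,f_n$. Let $T$ be the integral closure of $R$ in $K^*$ and let $S=T_{m_{\nu^*}\cap T}$ be the localization of $T$ at the center of $\nu^*$. Then $\mathrm{gr}_{\nu^*}(S)$ is integral over $\mathrm{gr}_\nu(R)$, via the natural homomorphism $\mathrm{gr}_\nu(R)\to\mathrm{gr}_{\nu^*}(S)$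 induced by the inclusion $R\subset S$. -/

import Mathlib

namespace ValGr

open DirectSum

section Graded

variable {A B Γ₀ : Type*} [CommRing A] [CommRing B] [LinearOrderedCommGroupWithZero Γ₀]

/-- The homogeneous component `P_γ(A) / P_γ⁺(A)` of degree `γ` of the associated graded ring of `A`
with respect to `v`. Mathlib's valuations are written multiplicatively with the order reversed, so
`P_γ(A) = {a | v a ≤ γ}` and `P_γ⁺(A) = {a | v a < γ}`. The degrees range over all `γ ≠ 0` in `Γ₀`;
if `γ` is not a value of `v` on `A`, the component is zero. -/
abbrev Piece (v : Valuation A Γ₀) (γ : Additive Γ₀ˣ) : Type _ :=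
  v.leAddSubgroup (γ.toMul : Γ₀) ⧸
    (v.ltAddSubgroup γ.toMul).addSubgroupOf (v.leAddSubgroup (γ.toMul : Γ₀))

/-- The class in `P_γ(A) / P_γ⁺(A)` of an element of `P_γ(A)`. -/
def cls (v : Valuation A Γ₀) (γ : Additive Γ₀ˣ) (a : A) (ha : v a ≤ (γ.toMul : Γ₀)) : Piece v γ :=
  QuotientAddGroup.mk ⟨a, ha⟩

lemma cls_surj (v : Valuation A Γ₀) (γ : Additive Γ₀ˣ) (x : Piece v γ) :
    ∃ (a : A) (ha : v a ≤ (γ.toMul : Γ₀)), cls v γ a ha = x := by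
  induction x using QuotientAddGroup.induction_on with
  | H z => exact ⟨z.1, z.2, rfl⟩

lemma cls_eq_iff (v : Valuation A Γ₀) (γ : Additive Γ₀ˣ) {a b : A}
    (ha : v a ≤ (γ.toMul : Γ₀)) (hb : v b ≤ (γ.toMul : Γ₀)) :
    cls v γ a ha = cls v γ b hb ↔ v (b - a) < (γ.toMul : Γ₀) := by
  unfold cls
  rw [QuotientAddGroup.eq, AddSubgroup.mem_addSubgroupOf]
  simp [neg_add_eq_sub]

lemma val_mul_le (v : Valuation A Γ₀) {γ δ : Additive Γ₀ˣ} {a b : A}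
    (ha : v a ≤ (γ.toMul : Γ₀)) (hb : v b ≤ (δ.toMul : Γ₀)) :
    v (a * b) ≤ ((γ + δ).toMul : Γ₀) := by
  rw [map_mul, toMul_add, Units.val_mul]
  exact mul_le_mul' ha hb

/-- Multiplication `P_γ/P_γ⁺ × P_δ/P_δ⁺ → P_{γ+δ}/P_{γ+δ}⁺`, induced by that of `A`. -/
def pieceMul (v : Valuation A Γ₀) {γ δ : Additive Γ₀ˣ} (x : Piece v γ) (y : Piece v δ) :
    Piece v (γ + δ) :=
  Quotient.liftOn₂' x y (fun a b => cls v (γ + δ) (a.1 * b.1) (val_mul_le v a.2 b.2)) (by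
    rintro ⟨a, ha⟩ ⟨b, hb⟩ ⟨a', ha'⟩ ⟨b', hb'⟩ h₁ h₂
    rw [QuotientAddGroup.leftRel_apply, AddSubgroup.mem_addSubgroupOf] at h₁ h₂
    have h₁' : v (a' - a) < (γ.toMul : Γ₀) := by simpa [neg_add_eq_sub] using h₁
    have h₂' : v (b' - b) < (δ.toMul : Γ₀) := by simpa [neg_add_eq_sub] using h₂
    rw [cls_eq_iff]
    have e : a' * b' - a * b = (a' - a) * b' + a * (b' - b) := by ring
    rw [e, toMul_add, Units.val_mul]
    refine v.map_add_lt ?_ ?_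
    · rw [map_mul]
      exact mul_lt_mul_of_lt_of_le_of_nonneg_of_pos h₁' hb' zero_le (Units.zero_lt _)
    · rw [map_mul]
      exact mul_lt_mul_of_le_of_lt_of_nonneg_of_pos ha h₂' zero_le (Units.zero_lt _))

lemma pieceMul_cls (v : Valuation A Γ₀) {γ δ : Additive Γ₀ˣ} {a b : A}
    (ha : v a ≤ (γ.toMul : Γ₀)) (hb : v b ≤ (δ.toMul : Γ₀)) :
    pieceMul v (cls v γ a ha) (cls v δ b hb) = cls v (γ + δ) (a * b) (val_mul_le v ha hb) := rfl

lemma cls_add (v : Valuation A Γ₀) {γ : Additive Γ₀ˣ} {a b : A}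
    (ha : v a ≤ (γ.toMul : Γ₀)) (hb : v b ≤ (γ.toMul : Γ₀)) :
    cls v γ a ha + cls v γ b hb = cls v γ (a + b) (v.map_add_le ha hb) := rfl

lemma cls_zero (v : Valuation A Γ₀) (γ : Additive Γ₀ˣ) :
    cls v γ 0 (by simp) = 0 := rfl

lemma cls_congr (v : Valuation A Γ₀) {γ : Additive Γ₀ˣ} {a b : A}
    (ha : v a ≤ (γ.toMul : Γ₀)) (h : a = b) : cls v γ a ha = cls v γ b (h ▸ ha) := by
  subst h; rfl

lemma mk_cls_congr (v : Valuation A Γ₀) {γ δ : Additive Γ₀ˣ} {a b : A}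
    (ha : v a ≤ (γ.toMul : Γ₀)) (hb : v b ≤ (δ.toMul : Γ₀)) (hγ : γ = δ) (h : a = b) :
    (GradedMonoid.mk γ (cls v γ a ha) : GradedMonoid (Piece v)) =
      GradedMonoid.mk δ (cls v δ b hb) := by
  subst hγ; subst h; rfl

instance gMul (v : Valuation A Γ₀) : GradedMonoid.GMul (Piece v) where
  mul x y := pieceMul v x y

instance gOne (v : Valuation A Γ₀) : GradedMonoid.GOne (Piece v) where
  one := cls v 0 1 (by simp)

instance gCommRing (v : Valuation A Γ₀) : DirectSum.GCommRing (Piece v) where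
  toGMul := gMul v
  toGOne := gOne v
  mul_zero {γ δ} x := by
    obtain ⟨a, ha, rfl⟩ := cls_surj v _ x
    rw [← cls_zero, ← cls_zero]
    exact cls_congr v _ (mul_zero a)
  zero_mul {γ δ} y := by
    obtain ⟨b, hb, rfl⟩ := cls_surj v _ y
    rw [← cls_zero, ← cls_zero]
    exact cls_congr v _ (zero_mul b)
  mul_add {γ δ} x y z := by
    obtain ⟨a, ha, rfl⟩ := cls_surj v _ x
    obtain ⟨b, hb, rfl⟩ := cls_surj v _ y
    obtain ⟨c, hc, rfl⟩ := cls_surj v _ z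
    exact cls_congr v _ (mul_add a b c)
  add_mul {γ δ} x y z := by
    obtain ⟨a, ha, rfl⟩ := cls_surj v _ x
    obtain ⟨b, hb, rfl⟩ := cls_surj v _ y
    obtain ⟨c, hc, rfl⟩ := cls_surj v _ z
    exact cls_congr v _ (add_mul a b c)
  one_mul := by
    rintro ⟨γ, x⟩
    obtain ⟨a, ha, rfl⟩ := cls_surj v _ x
    exact mk_cls_congr v _ _ (zero_add γ) (one_mul a)
  mul_one := by
    rintro ⟨γ, x⟩
    obtain ⟨a, ha, rfl⟩ := cls_surj v _ x
    exact mk_cls_congr v _ _ (add_zero γ) (mul_one a)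
  mul_assoc := by
    rintro ⟨γ, x⟩ ⟨δ, y⟩ ⟨ε, z⟩
    obtain ⟨a, ha, rfl⟩ := cls_surj v _ x
    obtain ⟨b, hb, rfl⟩ := cls_surj v _ y
    obtain ⟨c, hc, rfl⟩ := cls_surj v _ z
    exact mk_cls_congr v _ _ (add_assoc γ δ ε) (mul_assoc a b c)
  mul_comm := by
    rintro ⟨γ, x⟩ ⟨δ, y⟩
    obtain ⟨a, ha, rfl⟩ := cls_surj v _ x
    obtain ⟨b, hb, rfl⟩ := cls_surj v _ y
    exact mk_cls_congr v _ _ (add_comm γ δ) (mul_comm a b)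
  natCast n := n • cls v 0 1 (by simp)
  natCast_zero := zero_nsmul _
  natCast_succ n := succ_nsmul _ n
  intCast n := n • cls v 0 1 (by simp)
  intCast_ofNat n := natCast_zsmul _ n
  intCast_negSucc_ofNat n := negSucc_zsmul _ n

/-- The associated graded ring `gr_v(A) = ⨁_γ P_γ(A) / P_γ⁺(A)`, a commutative ring. -/
abbrev Gr (v : Valuation A Γ₀) : Type _ := ⨁ γ : Additive Γ₀ˣ, Piece v γ

/-- The map `P_γ(A) / P_γ⁺(A) → P_γ(B) / P_γ⁺(B)` induced by a ring homomorphism `φ : A → B`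
that respects the valuations. -/
def pieceMap {v : Valuation A Γ₀} {w : Valuation B Γ₀} (φ : A →+* B)
    (h : ∀ a, w (φ a) = v a) (γ : Additive Γ₀ˣ) : Piece v γ →+ Piece w γ :=
  QuotientAddGroup.map _ _
    ((φ.toAddMonoidHom.comp (v.leAddSubgroup (γ.toMul : Γ₀)).subtype).codRestrict
      (w.leAddSubgroup (γ.toMul : Γ₀)) (fun a => (h a.1).trans_le a.2))
    (fun a ha => (h a.1).trans_lt ha)

lemma pieceMap_cls {v : Valuation A Γ₀} {w : Valuation B Γ₀} (φ : A →+* B)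
    (h : ∀ a, w (φ a) = v a) (γ : Additive Γ₀ˣ) {a : A} (ha : v a ≤ (γ.toMul : Γ₀)) :
    pieceMap φ h γ (cls v γ a ha) = cls w γ (φ a) ((h a).trans_le ha) := rfl

/-- The graded ring homomorphism `gr_v(A) → gr_w(B)` induced by a ring homomorphism `φ : A → B`
that respects the valuations. -/
def grMap {v : Valuation A Γ₀} {w : Valuation B Γ₀} (φ : A →+* B)
    (h : ∀ a, w (φ a) = v a) : Gr v →+* Gr w :=
  DirectSum.toSemiring (fun γ => (DirectSum.of (Piece w) γ).comp (pieceMap φ h γ))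
    (by
      change DirectSum.of (Piece w) 0 (cls w 0 (φ 1) _) = DirectSum.of (Piece w) 0 (cls w 0 1 _)
      exact congrArg _ (cls_congr w _ (map_one φ)))
    (by
      intro γ δ x y
      obtain ⟨a, ha, rfl⟩ := cls_surj v _ x
      obtain ⟨b, hb, rfl⟩ := cls_surj v _ y
      simp only [AddMonoidHom.comp_apply]
      rw [DirectSum.of_mul_of]
      exact congrArg _ (cls_congr w _ (map_mul φ a b)))

end Graded

section LocalRings

variable {Γ₀ : Type*} [LinearOrderedCommGroupWithZero Γ₀]

/-- The local ring `A` is dominated by `v` (a valuation of its quotient field, restricted to `A`):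
`A` lies in the valuation ring of `v`, and the maximal ideal of `v` meets `A` in the maximal ideal
of `A`. -/
def IsDominated {A : Type*} [CommRing A] [IsLocalRing A] (v : Valuation A Γ₀) : Prop :=
  (∀ a, v a ≤ 1) ∧ ∀ a, v a < 1 ↔ a ∈ IsLocalRing.maximalIdeal A

/-- For a subring `A` of the valuation ring of `v`, the localization of `A` at the center
`{b ∈ A | v b < 1}` of `v` on `A`, as a subring of the field. -/
def localizationAtCenter {F : Type*} [Field F] (v : Valuation F Γ₀) (A : Subring F) :
    Subring F where
  carrier := {x | ∃ a ∈ A, ∃ b ∈ A, ¬ v b < 1 ∧ x = a / b}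
  mul_mem' := by
    rintro _ _ ⟨a, ha, b, hb, hvb, rfl⟩ ⟨c, hc, d, hd, hvd, rfl⟩
    refine ⟨a * c, A.mul_mem ha hc, b * d, A.mul_mem hb hd, ?_, div_mul_div_comm a b c d⟩
    rw [not_lt] at hvb hvd ⊢
    rw [map_mul]
    exact one_le_mul hvb hvd
  one_mem' := ⟨1, A.one_mem, 1, A.one_mem, by simp, by simp⟩
  add_mem' := by
    rintro _ _ ⟨a, ha, b, hb, hvb, rfl⟩ ⟨c, hc, d, hd, hvd, rfl⟩
    have hb0 : b ≠ 0 := by rintro rfl; simp at hvb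
    have hd0 : d ≠ 0 := by rintro rfl; simp at hvd
    refine ⟨a * d + b * c, A.add_mem (A.mul_mem ha hd) (A.mul_mem hb hc), b * d,
      A.mul_mem hb hd, ?_, div_add_div a c hb0 hd0⟩
    rw [not_lt] at hvb hvd ⊢
    rw [map_mul]
    exact one_le_mul hvb hvd
  zero_mem' := ⟨0, A.zero_mem, 1, A.one_mem, by simp, by simp⟩
  neg_mem' := by
    rintro _ ⟨a, ha, b, hb, hvb, rfl⟩
    exact ⟨-a, A.neg_mem ha, b, hb, hvb, by rw [neg_div]⟩

variable {k K L : Type*} [Field k] [Field K] [Field L] [Algebra k K] [Algebra K L]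

/-- The localization, at the center of `w`, of the integral closure of `R` in `L`. -/
def localRingAbove (w : Valuation L Γ₀) (R : Subalgebra k K) : Subring L :=
  localizationAtCenter w (integralClosure R L).toSubring

lemma algebraMap_mem_localRingAbove (w : Valuation L Γ₀) (R : Subalgebra k K) (r : R) :
    algebraMap K L r ∈ localRingAbove w R :=
  ⟨_, (integralClosure R L).algebraMap_mem r, 1, Subring.one_mem _, by simp, (div_one _).symm⟩

/-- The inclusion `R → S`, where `S` is the localization at the center of `w` of the integral
closure of `R` in `L`. -/
def toLocalRingAbove (w : Valuation L Γ₀) (R : Subalgebra k K) : R →+* localRingAbove w R :=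
  ((algebraMap K L).comp R.val.toRingHom).codRestrict _ (algebraMap_mem_localRingAbove w R)

/-- The natural homomorphism `gr_{w|K}(R) → gr_w(S)`, where `S` is the localization at the center of
`w` of the integral closure of `R` in `L`. -/
def grInclusion (w : Valuation L Γ₀) (R : Subalgebra k K) :
    Gr ((w.comap (algebraMap K L)).comap (algebraMap R K)) →+*
      Gr (w.comap (algebraMap (localRingAbove w R) L)) :=
  grMap (toLocalRingAbove w R) (fun _ => rfl)

end LocalRings

end ValGr

open scoped NNReal Polynomial

namespace Valuation

/-- The coefficients of a product of factors `X - a` are bounded by powers of a bound for the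
values of the roots `a`. -/
lemma coeff_multiset_prod_X_sub_C_le {A Γ : Type*} [CommRing A] [LinearOrderedCommGroupWithZero Γ]
    (v : Valuation A Γ) (c : Γ) (s : Multiset A) (hs : ∀ a ∈ s, v a ≤ c) (i : ℕ)
    (hi : i ≤ s.card) :
    v ((s.map fun a => Polynomial.X - Polynomial.C a).prod.coeff i) ≤ c ^ (s.card - i) := by
  induction s using Multiset.induction_on generalizing i with
  | empty =>
    obtain rfl : i = 0 := by simpa using hi
    simp
  | cons a s ih =>
    have hs' : ∀ b ∈ s, v b ≤ c := fun b hb => hs b (Multiset.mem_cons_of_mem hb)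
    have ha : v a ≤ c := hs a (Multiset.mem_cons_self a s)
    have hdeg : (s.map fun a => Polynomial.X - Polynomial.C a).prod.natDegree ≤ s.card := by
      refine (Polynomial.natDegree_multiset_prod_le _).trans ?_
      rw [Multiset.map_map]
      refine (Multiset.sum_le_card_nsmul _ 1 ?_).trans (by simp)
      simp only [Multiset.mem_map, Function.comp_apply, forall_exists_index, and_imp]
      rintro _ b - rfl
      exact Polynomial.natDegree_X_sub_C_le b
    rw [Multiset.map_cons, Multiset.prod_cons, sub_mul, Polynomial.coeff_sub,
      Polynomial.coeff_C_mul, Multiset.card_cons]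
    rw [Multiset.card_cons] at hi
    refine v.map_sub_le ?_ ?_
    · cases i with
      | zero => simp
      | succ j =>
        rw [Polynomial.coeff_X_mul]
        simpa using ih hs' j (by omega)
    · rcases hi.lt_or_eq with h | rfl
      · rw [map_mul, Nat.succ_sub (by omega), pow_succ']
        exact mul_le_mul' ha (ih hs' i (by omega))
      · rw [Polynomial.coeff_eq_zero_of_natDegree_lt (by omega)]
        simp

/-- If all conjugates of `y` have value at most `c`, the coefficients of the minimal polynomial of
`y` are bounded by powers of `c`. -/
lemma coeff_minpoly_le {K L Ω Γ : Type*} [Field K] [Field L] [Field Ω] [IsAlgClosed Ω]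
    [Algebra K L] [Algebra K Ω] [FiniteDimensional K L] [LinearOrderedCommGroupWithZero Γ]
    (v : Valuation Ω Γ) (y : L) (c : Γ) (h : ∀ τ : L →ₐ[K] Ω, v (τ y) ≤ c) (i : ℕ)
    (hi : i ≤ (minpoly K y).natDegree) :
    v (algebraMap K Ω ((minpoly K y).coeff i)) ≤ c ^ ((minpoly K y).natDegree - i) := by
  have hy : IsIntegral K y := Algebra.IsIntegral.isIntegral y
  have hsplit := IsAlgClosed.splits ((minpoly K y).map (algebraMap K Ω))
  have hprod := hsplit.eq_prod_roots_of_monic ((minpoly.monic hy).map _)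
  have hcard := hsplit.natDegree_eq_card_roots
  rw [Polynomial.natDegree_map] at hcard
  rw [← Polynomial.coeff_map, hprod, hcard]
  refine coeff_multiset_prod_X_sub_C_le v c _ (fun a ha => ?_) i (hcard ▸ hi)
  have ha' : a ∈ (minpoly K y).rootSet Ω := by
    rw [Polynomial.mem_rootSet_of_ne (minpoly.ne_zero hy), Polynomial.aeval_def,
      ← Polynomial.eval_map]
    exact (Polynomial.mem_roots'.mp ha).2
  rw [← Algebra.IsAlgebraic.range_eval_eq_rootSet_minpoly] at ha'
  obtain ⟨τ, rfl⟩ := ha'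
  exact h τ

/-- The absolute value defined by a valuation with values in `ℝ≥0`. -/
noncomputable def toAbs {F : Type*} [Field F] (v : Valuation F ℝ≥0) : AbsoluteValue F ℝ where
  toFun x := v x
  map_mul' x y := by simp
  nonneg' x := NNReal.coe_nonneg _
  eq_zero' x := by simp
  add_le' x y := by
    have h := v.map_add x y
    exact_mod_cast h.trans (max_le_add_of_nonneg zero_le zero_le)

lemma toAbs_apply {F : Type*} [Field F] (v : Valuation F ℝ≥0) (x : F) : v.toAbs x = v x := rfl

/-- A field with a nontrivial rank one valuation embeds, compatibly with valuations, in an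
algebraically closed one. -/
lemma exists_extension_isAlgClosed.{u} {L : Type u} [Field L] (v : Valuation L ℝ≥0)
    (hv : ∃ x, 1 < v x) :
    ∃ (Ω : Type u) (_ : Field Ω) (_ : IsAlgClosed Ω) (_ : Algebra L Ω) (v' : Valuation Ω ℝ≥0),
      ∀ x, v' (algebraMap L Ω x) = v x := by
  let a := v.toAbs
  have hcoe (x : L) : ‖((WithAbs.toAbs a x : WithAbs a) : a.Completion)‖ = v x := by
    rw [UniformSpace.Completion.norm_coe]; rfl
  let _ : NontriviallyNormedField a.Completion :=
    { (inferInstance : NormedField a.Completion) with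
      non_trivial := by
        obtain ⟨x, hx⟩ := hv
        exact ⟨((WithAbs.toAbs a x : WithAbs a) : a.Completion), by rw [hcoe]; exact_mod_cast hx⟩ }
  let f : L →+* a.Completion :=
    (UniformSpace.Completion.coeRingHom (α := WithAbs a)).comp (WithAbs.equiv a).symm.toRingHom
  have hf (x : L) : ‖f x‖ = v x := hcoe x
  have _ : IsUltrametricDist a.Completion := by
    refine IsUltrametricDist.isUltrametricDist_of_forall_norm_natCast_le_one fun n => ?_
    rw [← map_natCast f, hf]
    have : v (n : L) ≤ 1 := by
      induction n with
      | zero => simp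
      | succ n ih => push_cast; exact v.map_add_le ih (by simp)
    exact_mod_cast this
  let Ω := AlgebraicClosure a.Completion
  let v' : Valuation Ω ℝ≥0 :=
    { toFun x := ⟨spectralNorm a.Completion Ω x, spectralNorm_nonneg x⟩
      map_zero' := by ext; exact spectralNorm_zero
      map_one' := by ext; exact spectralNorm_one
      map_mul' x y := by ext; exact spectralAlgNorm_mul x y
      map_add_le_max' x y := isNonarchimedean_spectralNorm x y }
  refine ⟨Ω, inferInstance, inferInstance, ((algebraMap a.Completion Ω).comp f).toAlgebra, v', ?_⟩
  intro x
  ext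
  exact (spectralNorm_extends (f x)).trans (hf x)

/-- A valuation that takes values at most one on the image of `A` does so on all elements integral
over `A`. -/
lemma le_one_of_isIntegral {A L Γ : Type*} [CommRing A] [Field L] [Algebra A L]
    [LinearOrderedCommGroupWithZero Γ] (v : Valuation L Γ) (hA : ∀ a, v (algebraMap A L a) ≤ 1)
    {x : L} (hx : IsIntegral A x) : v x ≤ 1 := by
  obtain ⟨p, hp, hpx⟩ := hx
  let f : A →+* v.integer := (algebraMap A L).codRestrict v.integer hA
  refine (integer.integers v).mem_of_integral ⟨p.map f, hp.map f, ?_⟩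
  rw [Polynomial.eval₂_map]
  exact hpx

/-- Equivalent real-valued valuations that agree and are nontrivial on a subfield are equal. -/
lemma eq_of_toAbs_isEquiv {K L : Type*} [Field K] [Field L] [Algebra K L]
    (v v' : Valuation L ℝ≥0)
    (hK : ∀ c : K, v (algebraMap K L c) = v' (algebraMap K L c)) {c : K}
    (hc : 1 < v (algebraMap K L c)) (h : v.toAbs.IsEquiv v'.toAbs) : v = v' := by
  obtain ⟨t, ht, hvv⟩ := AbsoluteValue.isEquiv_iff_exists_rpow_eq.mp h
  have key (x : L) : (v x : ℝ) ^ t = v' x := congrFun hvv x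
  have ht1 : t = 1 := by
    have h1 := key (algebraMap K L c)
    rw [← hK] at h1
    have hc' : (1 : ℝ) < v (algebraMap K L c) := by exact_mod_cast hc
    exact (Real.rpow_right_inj (by linarith) hc'.ne').mp (h1.trans (Real.rpow_one _).symm)
  ext x
  rw [← key x, ht1, Real.rpow_one]

section Conjugates

variable {K L Ω : Type*} [Field K] [Field L] [Field Ω] [Algebra K L] [Algebra L Ω] [Algebra K Ω]
  [FiniteDimensional K L]

/-- There is an element of value one all of whose conjugates have value less than one, except
those with respect to embeddings that preserve the valuation. -/
lemma exists_eq_one_and_conj_lt_one [IsScalarTower K L Ω] (v : Valuation Ω ℝ≥0)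
    (hv : ∃ x : L, 1 < v (algebraMap L Ω x)) :
    ∃ u : L, v (algebraMap L Ω u) = 1 ∧
      ∀ τ : L →ₐ[K] Ω, (∀ x, v (τ x) = v (algebraMap L Ω x)) ∨ v (τ u) < 1 := by
  obtain ⟨c, hc⟩ : ∃ c : K, 1 < v (algebraMap K Ω c) := by
    by_contra! h
    obtain ⟨x, hx⟩ := hv
    refine hx.not_ge (v.le_one_of_isIntegral h ?_)
    exact (Algebra.IsIntegral.isIntegral (R := K) x).algebraMap
  let val (τ : L →ₐ[K] Ω) : Valuation L ℝ≥0 := v.comap (τ : L →+* Ω)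
  have hval (τ : L →ₐ[K] Ω) (d : K) : val τ (algebraMap K L d) = v (algebraMap K Ω d) := by
    change v (τ _) = _
    rw [τ.commutes]
  let ι : Type _ := Set.range val
  have : Finite ι := Set.finite_range val
  let τ₀ : L →ₐ[K] Ω := IsScalarTower.toAlgHom K L Ω
  have hnt (i : ι) : i.1.toAbs.IsNontrivial := by
    obtain ⟨-, τ, rfl⟩ := i
    refine ⟨algebraMap K L c, fun h0 => ?_, fun h1 => ?_⟩
    · have := hval τ c
      rw [h0, map_zero] at this
      rw [← this] at hc
      exact not_lt_of_ge zero_le hc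
    · rw [toAbs_apply, hval] at h1
      exact hc.ne' (by exact_mod_cast h1)
  have hne : Pairwise fun i j : ι => ¬ i.1.toAbs.IsEquiv j.1.toAbs := by
    rintro ⟨-, τ, rfl⟩ ⟨-, σ, rfl⟩ hij h
    refine hij (Subtype.ext (eq_of_toAbs_isEquiv (K := K) _ _ (fun d => ?_) (c := c) ?_ h))
    · rw [hval, hval]
    · rwa [hval]
  obtain ⟨a, ha, ha'⟩ := AbsoluteValue.exists_one_lt_lt_one_pi_of_not_isEquiv hnt hne
    ⟨val τ₀, τ₀, rfl⟩
  have ha : 1 < val τ₀ a := by exact_mod_cast ha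
  refine ⟨a / (1 + a), ?_, fun τ => ?_⟩
  · change val τ₀ (a / (1 + a)) = 1
    have hadd : val τ₀ (1 + a) = val τ₀ a :=
      Valuation.map_add_eq_of_lt_right (val τ₀) (x := 1) (by simpa using ha)
    rw [map_div₀, hadd]
    exact div_self (by rintro h; simp [h] at ha)
  · by_cases h : val τ = val τ₀
    · exact Or.inl fun x => congrArg (fun f : Valuation L ℝ≥0 => f x) h
    · right
      have hτ : val τ a < 1 := by
        exact_mod_cast ha' ⟨val τ, τ, rfl⟩ fun h' => h (congrArg Subtype.val h')
      change val τ (a / (1 + a)) < 1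
      have hadd : val τ (1 + a) = 1 := by
        rw [Valuation.map_add_eq_of_lt_left (val τ) (x := 1) (by simpa using hτ), map_one]
      rwa [map_div₀, hadd, div_one]

/-- Multiplying an integral element by a high power of an element as in
`exists_eq_one_and_conj_lt_one` makes its value the largest among its conjugates. -/
lemma exists_pow_mul_conj_le (v : Valuation Ω ℝ≥0) {u t : L}
    (hu : v (algebraMap L Ω u) = 1)
    (hconj : ∀ τ : L →ₐ[K] Ω, (∀ x, v (τ x) = v (algebraMap L Ω x)) ∨ v (τ u) < 1)
    (ht : t ≠ 0) (ht1 : ∀ τ : L →ₐ[K] Ω, v (τ t) ≤ 1) :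
    ∃ N : ℕ, ∀ τ : L →ₐ[K] Ω, v (τ (u ^ N * t)) ≤ v (algebraMap L Ω t) := by
  have hpos : 0 < v (algebraMap L Ω t) := by
    rw [pos_iff_ne_zero, Valuation.ne_zero_iff]
    simpa using ht
  have key (τ : L →ₐ[K] Ω) :
      ∀ᶠ N : ℕ in Filter.atTop, v (τ (u ^ N * t)) ≤ v (algebraMap L Ω t) := by
    rcases hconj τ with h | h
    · exact Filter.Eventually.of_forall fun N => by simp [h, hu]
    · have hlim := NNReal.tendsto_pow_atTop_nhds_zero_of_lt_one h
      filter_upwards [hlim.eventually_le_const hpos] with N hN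
      rw [map_mul, map_mul, map_pow, map_pow]
      exact (mul_le_of_le_one_right' (ht1 τ)).trans hN
  exact (Filter.eventually_all.mpr key).exists

end Conjugates

end Valuation

namespace ValGr

section Homogeneous

variable {A B Γ₀ : Type*} [CommRing A] [CommRing B] [LinearOrderedCommGroupWithZero Γ₀]

/-- The homogeneous element of degree `γ` of the associated graded ring defined by `a`. -/
def homog (v : Valuation A Γ₀) (γ : Additive Γ₀ˣ) (a : A) (ha : v a ≤ (γ.toMul : Γ₀)) : Gr v :=
  DirectSum.of (Piece v) γ (cls v γ a ha)

lemma homog_eq (v : Valuation A Γ₀) {γ δ : Additive Γ₀ˣ} {a b : A}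
    (ha : v a ≤ (γ.toMul : Γ₀)) (hb : v b ≤ (δ.toMul : Γ₀)) (hγ : γ = δ)
    (h : v (b - a) < (γ.toMul : Γ₀)) : homog v γ a ha = homog v δ b hb := by
  subst hγ
  exact congrArg _ ((cls_eq_iff v γ ha hb).mpr h)

lemma homog_congr (v : Valuation A Γ₀) {γ δ : Additive Γ₀ˣ} {a b : A}
    (ha : v a ≤ (γ.toMul : Γ₀)) (hb : v b ≤ (δ.toMul : Γ₀)) (hγ : γ = δ) (h : a = b) :
    homog v γ a ha = homog v δ b hb := by
  subst hγ; subst h; rfl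

lemma homog_eq_zero (v : Valuation A Γ₀) {γ : Additive Γ₀ˣ} {a : A} (h : v a < (γ.toMul : Γ₀)) :
    homog v γ a h.le = 0 :=
  (homog_eq v h.le (by simp) rfl (by simpa using h)).trans
    ((congrArg _ (cls_zero v γ)).trans (map_zero _))

lemma homog_add (v : Valuation A Γ₀) {γ : Additive Γ₀ˣ} {a b : A}
    (ha : v a ≤ (γ.toMul : Γ₀)) (hb : v b ≤ (γ.toMul : Γ₀)) :
    homog v γ a ha + homog v γ b hb = homog v γ (a + b) (v.map_add_le ha hb) :=
  (map_add (DirectSum.of (Piece v) γ) _ _).symm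

lemma homog_sum (v : Valuation A Γ₀) {γ : Additive Γ₀ˣ} {ι : Type*} (s : Finset ι) (f : ι → A)
    (hf : ∀ i, v (f i) ≤ (γ.toMul : Γ₀)) :
    ∑ i ∈ s, homog v γ (f i) (hf i) =
      homog v γ (∑ i ∈ s, f i) (v.map_sum_le fun i _ => hf i) := by
  classical
  induction s using Finset.induction_on with
  | empty => exact (homog_eq_zero v (γ := γ) (a := 0) (by simp)).symm
  | insert i s hi ih =>
    rw [Finset.sum_insert hi, ih, homog_add]
    exact homog_congr v _ _ rfl (Finset.sum_insert hi).symm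

lemma homog_mul (v : Valuation A Γ₀) {γ δ : Additive Γ₀ˣ} {a b : A}
    (ha : v a ≤ (γ.toMul : Γ₀)) (hb : v b ≤ (δ.toMul : Γ₀)) :
    homog v γ a ha * homog v δ b hb = homog v (γ + δ) (a * b) (val_mul_le v ha hb) :=
  DirectSum.of_mul_of _ _

lemma homog_one (v : Valuation A Γ₀) : homog v 0 1 (by simp) = 1 := rfl

lemma val_pow_le (v : Valuation A Γ₀) {γ : Additive Γ₀ˣ} {a : A}
    (ha : v a ≤ (γ.toMul : Γ₀)) (n : ℕ) : v (a ^ n) ≤ ((n • γ).toMul : Γ₀) := by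
  rw [map_pow, toMul_nsmul, Units.val_pow_eq_pow_val]
  exact pow_le_pow_left' ha n

lemma homog_pow (v : Valuation A Γ₀) {γ : Additive Γ₀ˣ} {a : A}
    (ha : v a ≤ (γ.toMul : Γ₀)) (n : ℕ) :
    homog v γ a ha ^ n = homog v (n • γ) (a ^ n) (val_pow_le v ha n) := by
  induction n with
  | zero =>
    rw [pow_zero, ← homog_one]
    exact homog_congr v _ _ (zero_nsmul γ).symm (pow_zero a).symm
  | succ n ih =>
    rw [pow_succ, ih, homog_mul]
    exact homog_congr v _ _ (succ_nsmul γ n).symm (pow_succ a n).symm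

lemma grMap_homog {v : Valuation A Γ₀} {w : Valuation B Γ₀} (φ : A →+* B)
    (h : ∀ a, w (φ a) = v a) {γ : Additive Γ₀ˣ} {a : A} (ha : v a ≤ (γ.toMul : Γ₀)) :
    grMap φ h (homog v γ a ha) = homog w γ (φ a) ((h a).trans_le ha) :=
  DirectSum.toSemiring_of _ _ _ _ _

/-- The graded ring of `B` is integral over that of `A` as soon as this holds for the homogeneous
elements given by elements whose value is the degree. -/
lemma grMap_isIntegral {v : Valuation A Γ₀} {w : Valuation B Γ₀} (φ : A →+* B)
    (h : ∀ a, w (φ a) = v a)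
    (H : ∀ (γ : Additive Γ₀ˣ) (b : B) (hb : w b = (γ.toMul : Γ₀)),
      (grMap φ h).IsIntegralElem (homog w γ b hb.le)) : (grMap φ h).IsIntegral := by
  intro x
  induction x using DirectSum.induction_on with
  | zero => exact RingHom.isIntegralElem_zero _
  | of γ x =>
    obtain ⟨b, hb, rfl⟩ := cls_surj w γ x
    rcases hb.lt_or_eq with hlt | heq
    · have hz : DirectSum.of (Piece w) γ (cls w γ b hb) = 0 := homog_eq_zero w hlt
      rw [hz]
      exact RingHom.isIntegralElem_zero _
    · exact H γ b heq
  | add x y hx hy => exact RingHom.IsIntegralElem.add _ hx hy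

/-- A monic polynomial whose coefficients have the values expected of a homogeneous equation, and
whose value at `x` is small, gives an integral equation for the initial form of `x`. -/
lemma isIntegralElem_homog {v : Valuation A Γ₀} {w : Valuation B Γ₀} (φ : A →+* B)
    (h : ∀ a, w (φ a) = v a) {γ : Additive Γ₀ˣ} {x : B} (hx : w x ≤ (γ.toMul : Γ₀))
    (p : A[X]) (hp : p.Monic)
    (hcoeff : ∀ i ≤ p.natDegree, v (p.coeff i) ≤ (γ.toMul : Γ₀) ^ (p.natDegree - i))
    (hpx : w (p.eval₂ φ x) < (γ.toMul : Γ₀) ^ p.natDegree) :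
    (grMap φ h).IsIntegralElem (homog w γ x hx) := by
  set n := p.natDegree with hn
  have hc (i : Fin n) : v (p.coeff i) ≤ (((n - i) • γ).toMul : Γ₀) := by
    rw [toMul_nsmul, Units.val_pow_eq_pow_val]
    exact hcoeff i i.2.le
  have hpow : (((n • γ).toMul : Γ₀ˣ) : Γ₀) = (γ.toMul : Γ₀) ^ n := by
    rw [toMul_nsmul, Units.val_pow_eq_pow_val]
  have hterm (i : Fin n) : w (φ (p.coeff i) * x ^ (i : ℕ)) ≤ ((n • γ).toMul : Γ₀) := by
    have h1 := val_mul_le w (((h _).trans_le (hc i))) (val_pow_le w hx i)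
    rwa [← add_nsmul, Nat.sub_add_cancel i.2.le] at h1
  refine ⟨Polynomial.X ^ n + ∑ i : Fin n, Polynomial.C (homog v ((n - i) • γ) (p.coeff i) (hc i)) *
    Polynomial.X ^ (i : ℕ), Polynomial.monic_X_pow_add ?_, ?_⟩
  · refine Polynomial.mem_degreeLT.mp
      (Submodule.sum_mem _ fun i _ => Polynomial.mem_degreeLT.mpr ?_)
    exact (Polynomial.degree_C_mul_X_pow_le _ _).trans_lt (by exact_mod_cast i.2)
  · rw [Polynomial.eval₂_add, Polynomial.eval₂_X_pow, Polynomial.eval₂_finsetSum, homog_pow]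
    have hsum : ∑ i : Fin n, Polynomial.eval₂ (grMap φ h) (homog w γ x hx)
        (Polynomial.C (homog v ((n - i) • γ) (p.coeff i) (hc i)) * Polynomial.X ^ (i : ℕ)) =
        ∑ i : Fin n, homog w (n • γ) (φ (p.coeff i) * x ^ (i : ℕ)) (hterm i) := by
      refine Finset.sum_congr rfl fun i _ => ?_
      rw [Polynomial.eval₂_mul, Polynomial.eval₂_C, Polynomial.eval₂_X_pow, homog_pow,
        grMap_homog, homog_mul]
      exact homog_congr w _ _ (by rw [← add_nsmul, Nat.sub_add_cancel i.2.le]) rfl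
    rw [hsum, homog_sum, homog_add]
    refine homog_eq_zero w ?_
    rw [hpow]
    convert hpx using 2
    rw [Polynomial.eval₂_eq_sum_range, Finset.sum_range_succ, ← hn, hn, hp.coeff_natDegree, ← hn,
      map_one, one_mul, add_comm, Finset.sum_range]

/-- Polynomial expressions in an element whose initial form of degree zero is integral have the
same property. -/
lemma isIntegralElem_homog_eval₂ {v : Valuation A Γ₀} {w : Valuation B Γ₀} (φ : A →+* B)
    (h : ∀ a, w (φ a) = v a) (hv : ∀ a, v a ≤ 1) {c : B}
    (hc : w c ≤ ((0 : Additive Γ₀ˣ).toMul : Γ₀))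
    (hint : (grMap φ h).IsIntegralElem (homog w 0 c hc)) (q : A[X]) :
    ∃ hq : w (q.eval₂ φ c) ≤ ((0 : Additive Γ₀ˣ).toMul : Γ₀),
      (grMap φ h).IsIntegralElem (homog w 0 (q.eval₂ φ c) hq) := by
  have hC (a : A) : v a ≤ ((0 : Additive Γ₀ˣ).toMul : Γ₀) := by simpa using hv a
  have hpow (n : ℕ) : w (c ^ n) ≤ ((0 : Additive Γ₀ˣ).toMul : Γ₀) := by
    simpa using val_pow_le w hc n
  have hmono (n : ℕ) (a : A) : w (φ a * c ^ n) ≤ ((0 : Additive Γ₀ˣ).toMul : Γ₀) := by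
    simpa using val_mul_le w ((h a).trans_le (hC a)) (hpow n)
  induction q using Polynomial.induction_on' with
  | add p q hp hq =>
    obtain ⟨hp, hp'⟩ := hp
    obtain ⟨hq, hq'⟩ := hq
    refine ⟨by rw [Polynomial.eval₂_add]; exact w.map_add_le hp hq, ?_⟩
    rw [homog_congr w _ (w.map_add_le hp hq) rfl (Polynomial.eval₂_add φ c), ← homog_add w hp hq]
    exact hp'.add _ hq'
  | monomial n a =>
    refine ⟨by rw [Polynomial.eval₂_monomial]; exact hmono n a, ?_⟩
    have : homog w 0 ((Polynomial.monomial n a).eval₂ φ c)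
        (by rw [Polynomial.eval₂_monomial]; exact hmono n a) =
        grMap φ h (homog v 0 a (hC a)) * homog w 0 c hc ^ n := by
      rw [grMap_homog, homog_pow, homog_mul]
      exact homog_congr w _ _ (by simp) (Polynomial.eval₂_monomial φ c)
    rw [this]
    let _ := (grMap φ h).toAlgebra
    exact ((grMap φ h).isIntegralElem_map).mul _ (IsIntegral.pow hint n)

/-- An element of degree zero whose inverse satisfies an integral equation modulo the maximal
ideal is integral over the graded ring of a dominated local ring. -/
lemma isIntegralElem_homog_inv {v : Valuation A Γ₀} {w : Valuation B Γ₀} (φ : A →+* B)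
    (h : ∀ a, w (φ a) = v a) (hv : ∀ a, v a ≤ 1) (hunit : ∀ a, v a = 1 → IsUnit a)
    {c c' : B} (hcc : c * c' = 1) (hc : w c = 1) (hc' : w c' = 1) (p : A[X]) (hp : p.Monic)
    (hpc : w (p.eval₂ φ c) < 1) :
    (grMap φ h).IsIntegralElem (homog w 0 c' (by simp [hc'])) := by
  induction hn : p.natDegree generalizing p with
  | zero =>
    rw [hp.natDegree_eq_zero.mp hn] at hpc
    simp at hpc
  | succ n ih =>
    have hdeg : p.divX.natDegree = n := by
      rw [Polynomial.natDegree_divX_eq_natDegree_tsub_one, hn, Nat.add_sub_cancel]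
    have hmonic : p.divX.Monic := by
      rw [Polynomial.Monic, Polynomial.leadingCoeff, hdeg, Polynomial.coeff_divX, ← hn]
      exact hp
    have hsplit : p.eval₂ φ c = p.divX.eval₂ φ c * c + φ (p.coeff 0) := by
      conv_lhs => rw [← Polynomial.divX_mul_X_add p]
      simp
    rcases (hv (p.coeff 0)).lt_or_eq with hlt | heq
    · refine ih p.divX hmonic ?_ hdeg
      have : w (p.divX.eval₂ φ c * c) < 1 := by
        rw [eq_sub_of_add_eq hsplit.symm]
        exact w.map_sub_lt hpc ((h _).trans_lt hlt)
      simpa [hc] using this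
    · obtain ⟨r, hr⟩ := hunit _ heq
      have hinv : φ ((r⁻¹ : Aˣ) : A) * φ (p.coeff 0) = 1 := by
        rw [← map_mul, ← hr, Units.inv_mul, map_one]
      have hwinv : w (φ ((r⁻¹ : Aˣ) : A)) ≤ 1 := (h _).trans_le (hv _)
      obtain ⟨hq, hq'⟩ := isIntegralElem_homog_eval₂ φ h hv (c := c) (by simp [hc])
        (isIntegralElem_homog φ h _ p hp (fun i _ => by simpa using hv _) (by simpa using hpc))
        p.divX
      have hz : v (-((r⁻¹ : Aˣ) : A)) ≤ ((0 : Additive Γ₀ˣ).toMul : Γ₀) := by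
        simpa using hv ((r⁻¹ : Aˣ) : A)
      have key : homog w 0 c' (by simp [hc']) =
          grMap φ h (homog v 0 (-((r⁻¹ : Aˣ) : A)) hz) * homog w 0 (p.divX.eval₂ φ c) hq := by
        rw [grMap_homog, homog_mul]
        refine homog_eq w _ _ (add_zero 0).symm ?_
        have : φ (-((r⁻¹ : Aˣ) : A)) * p.divX.eval₂ φ c - c' =
            -(φ ((r⁻¹ : Aˣ) : A) * c' * p.eval₂ φ c) := by
          rw [hsplit, map_neg]
          linear_combination (φ ((r⁻¹ : Aˣ) : A) * p.divX.eval₂ φ c) * hcc + c' * hinv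
        rw [this, Valuation.map_neg, map_mul, map_mul, hc', mul_one]
        exact (mul_le_of_le_one_left' hwinv).trans_lt (by simpa using hpc)
      rw [key]
      exact ((grMap φ h).isIntegralElem_map).mul _ hq'

end Homogeneous

end ValGr

namespace Valuation

variable {K L Γ₀ : Type*} [Field K] [Field L] [Algebra K L] [LinearOrderedCommGroupWithZero Γ₀]

/-- A rank one valuation is equivalent to a nontrivial one with values in `ℝ≥0`. -/
lemma RankOne.exists_isEquiv_nnreal (w : Valuation L Γ₀) (hw : w.RankOne) :
    ∃ v : Valuation L ℝ≥0, v.IsEquiv w ∧ ∃ x, 1 < v x := by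
  let v : Valuation L ℝ≥0 :=
    w.restrict.map (RankOne.hom w) (RankOne.strictMono w).monotone
  have hv : v.IsEquiv w := fun x y =>
    (RankOne.strictMono w).le_iff_le.trans w.restrict_le_iff
  refine ⟨v, hv, ?_⟩
  obtain ⟨x, hx0, hx1⟩ := RankOne.nontrivial w
  rcases lt_or_gt_of_ne hx1 with h | h
  · refine ⟨x⁻¹, ?_⟩
    rw [hv.one_lt_iff_one_lt, map_inv₀]
    exact (one_lt_inv₀ (zero_lt_iff.mpr hx0)).mpr h
  · exact ⟨x, hv.one_lt_iff_one_lt.mpr h⟩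

/-- For a rank one valuation `w` of a finite extension `L / K` there is an element `u` of value
one, integral over the valuation ring of `w` on `K`, such that for all integral `t ≠ 0` the minimal
polynomial of some `u ^ N * t` is homogeneous in values. -/
lemma exists_pow_mul_coeff_minpoly_le [FiniteDimensional K L] (w : Valuation L Γ₀)
    (hw : w.RankOne) :
    ∃ u : L, w u = 1 ∧ (∀ i, w (algebraMap K L ((minpoly K u).coeff i)) ≤ 1) ∧
      ∀ t : L, t ≠ 0 → IsIntegral (w.comap (algebraMap K L)).integer t →
        ∃ N : ℕ, ∀ i ≤ (minpoly K (u ^ N * t)).natDegree,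
          w (algebraMap K L ((minpoly K (u ^ N * t)).coeff i)) ≤
            w t ^ ((minpoly K (u ^ N * t)).natDegree - i) := by
  obtain ⟨v, hvw, hv⟩ := RankOne.exists_isEquiv_nnreal w hw
  obtain ⟨Ω, _, _, _, v', hv'⟩ := exists_extension_isAlgClosed v hv
  let _ : Algebra K Ω := ((algebraMap L Ω).comp (algebraMap K L)).toAlgebra
  have : IsScalarTower K L Ω := IsScalarTower.of_algebraMap_eq fun _ => rfl
  have hK (c : K) : v' (algebraMap K Ω c) = v (algebraMap K L c) := hv' _
  obtain ⟨u, hu, hconj⟩ := exists_eq_one_and_conj_lt_one (K := K) (L := L) v'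
    (by simpa only [hv'] using hv)
  refine ⟨u, ?_, fun i => ?_, fun t ht hint => ?_⟩
  · rw [← hvw.eq_one_iff_eq_one, ← hv', hu]
  · rw [← hvw.le_one_iff_le_one, ← hK]
    rcases le_or_gt i (minpoly K u).natDegree with hi | hi
    · have := v'.coeff_minpoly_le u 1 (fun τ => ?_) i hi
      · simpa using this
      · rcases hconj τ with h | h
        · rw [h, hu]
        · exact h.le
    · simp [Polynomial.coeff_eq_zero_of_natDegree_lt hi]
  · have ht1 (τ : L →ₐ[K] Ω) : v' (τ t) ≤ 1 := by
      refine v'.le_one_of_isIntegral (A := (w.comap (algebraMap K L)).integer) (fun a => ?_)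
        (hint.map (τ.restrictScalars (w.comap (algebraMap K L)).integer))
      change v' (algebraMap K Ω a) ≤ 1
      rw [hK, hvw.le_one_iff_le_one]
      exact a.2
    obtain ⟨N, hN⟩ := v'.exists_pow_mul_conj_le hu hconj ht ht1
    refine ⟨N, fun i hi => ?_⟩
    rw [← map_pow, ← hvw, ← hK, map_pow, ← hv' t]
    exact v'.coeff_minpoly_le _ _ hN i hi

end Valuation

namespace ValGr

variable {k K L Γ₀ : Type*} [Field k] [Field K] [Field L] [Algebra k K] [Algebra K L]
  [LinearOrderedCommGroupWithZero Γ₀]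

lemma mem_localRingAbove {w : Valuation L Γ₀} {R : Subalgebra k K} {a : L} (ha : IsIntegral R a) :
    a ∈ localRingAbove w R :=
  ⟨a, ha, 1, Subring.one_mem _, by simp, (div_one a).symm⟩

lemma coe_eval₂_toLocalRingAbove {w : Valuation L Γ₀} {R : Subalgebra k K} (p : R[X])
    (x : localRingAbove w R) :
    ((p.eval₂ (toLocalRingAbove w R) x : localRingAbove w R) : L) = Polynomial.aeval (x : L) p :=
  Polynomial.hom_eval₂ p (toLocalRingAbove w R) (localRingAbove w R).subtype x

end ValGr

open ValGr in
theorem mainTheorem2 {k K L Γ₀ : Type*} [Field k] [Field K] [Field L]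
    [Algebra k K] [Algebra K L] [Algebra k L] [IsScalarTower k K L]
    (hK : (⊤ : IntermediateField k K).FG) [FiniteDimensional K L]
    [LinearOrderedCommGroupWithZero Γ₀] (w : Valuation L Γ₀)
    (hw : w.IsTrivialOn k) (hrank : Nonempty w.RankOne) :
    ∃ F : Finset K, (∀ f ∈ F, w.comap (algebraMap K L) f ≤ 1) ∧
      ∀ (R : Subalgebra k K) [IsLocalRing R] [IsFractionRing R K]
        [Algebra.EssFiniteType k R] [IsIntegrallyClosed R],
        ValGr.IsDominated ((w.comap (algebraMap K L)).comap (algebraMap R K)) →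
        (∀ f ∈ F, f ∈ R) →
        (ValGr.grInclusion w R).IsIntegral := by
  classical
  obtain ⟨u, hu, hucoeff, hpow⟩ := Valuation.exists_pow_mul_coeff_minpoly_le (K := K) w hrank.some
  refine ⟨(minpoly K u).coeffs, fun f hf => ?_, fun R _ _ _ _ hdom hF => ?_⟩
  · obtain ⟨i, -, rfl⟩ := Polynomial.mem_coeffs_iff.mp hf
    exact hucoeff i
  have hR (r : R) : w (algebraMap R L r) ≤ 1 := hdom.1 r
  have huR : IsIntegral R u := by
    have hmem : minpoly K u ∈ Polynomial.lifts (algebraMap R K) := by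
      rw [Polynomial.lifts_iff_coeffs_subset_range]
      exact fun f hf => ⟨⟨f, hF f hf⟩, rfl⟩
    obtain ⟨p, hp, -, hmonic⟩ := Polynomial.lifts_and_natDegree_eq_and_monic hmem
      (minpoly.monic (Algebra.IsIntegral.isIntegral u))
    refine ⟨p, hmonic, ?_⟩
    rw [← Polynomial.aeval_def, ← Polynomial.aeval_map_algebraMap K, hp, minpoly.aeval]
  refine grMap_isIntegral _ _ ?_
  rintro γ ⟨s, t, ht, b, hb, hbw, rfl⟩ hs
  have ht : IsIntegral R t := ht
  have hb : IsIntegral R b := hb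
  have hwb : w b = 1 := le_antisymm (w.le_one_of_isIntegral hR hb) (not_lt.mp hbw)
  have hwt : w t = (γ.toMul : Γ₀) := by
    change w (t / b) = _ at hs
    rwa [map_div₀, hwb, div_one] at hs
  have ht0 : t ≠ 0 := by
    rintro rfl
    rw [map_zero] at hwt
    exact (Units.ne_zero _ hwt.symm).elim
  have htO : IsIntegral (w.comap (algebraMap K L)).integer t := by
    obtain ⟨p, hp, hpt⟩ := ht
    let f : R →+* (w.comap (algebraMap K L)).integer := (algebraMap R K).codRestrict _ hR
    refine ⟨p.map f, hp.map f, ?_⟩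
    rw [Polynomial.eval₂_map]
    exact hpt
  obtain ⟨N, hN⟩ := hpow t ht0 htO
  have hyR : IsIntegral R (u ^ N * t) := (huR.pow N).mul ht
  have hcR : IsIntegral R (u ^ N * b) := (huR.pow N).mul hb
  have hwy : w (u ^ N * t) = (γ.toMul : Γ₀) := by simp [hu, hwt]
  have hwc : w (u ^ N * b) = 1 := by simp [hu, hwb]
  have hc0 : u ^ N * b ≠ 0 := by
    rw [← w.ne_zero_iff, hwc]
    exact one_ne_zero
  let y : localRingAbove w R := ⟨u ^ N * t, mem_localRingAbove hyR⟩
  let c : localRingAbove w R := ⟨u ^ N * b, mem_localRingAbove hcR⟩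
  let c' : localRingAbove w R :=
    ⟨(u ^ N * b)⁻¹, 1, Subring.one_mem _, _, hcR, by simp [hwc], (one_div _).symm⟩
  have hminpoly : minpoly K (u ^ N * t) = (minpoly R (u ^ N * t)).map (algebraMap R K) :=
    minpoly.isIntegrallyClosed_eq_field_fractions' K hyR
  have hy : (grInclusion w R).IsIntegralElem (homog _ γ y hwy.le) := by
    refine isIntegralElem_homog _ _ _ (minpoly R (u ^ N * t)) (minpoly.monic hyR)
      (fun i hi => ?_) ?_
    · have hdeg : (minpoly K (u ^ N * t)).natDegree = (minpoly R (u ^ N * t)).natDegree := by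
        rw [hminpoly, (minpoly.monic hyR).natDegree_map]
      have := hN i (hdeg ▸ hi)
      rwa [hdeg, hminpoly, Polynomial.coeff_map, hwt] at this
    · change w ((Polynomial.eval₂ (toLocalRingAbove w R) y _ : localRingAbove w R) : L) < _
      rw [coe_eval₂_toLocalRingAbove, minpoly.aeval, map_zero]
      exact zero_lt_iff.mpr (pow_ne_zero _ (Units.ne_zero _))
  have hwc' : w (u ^ N * b)⁻¹ = 1 := by rw [map_inv₀, hwc, inv_one]
  have hc' : (grInclusion w R).IsIntegralElem (homog _ 0 c' hwc'.le) := by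
    refine isIntegralElem_homog_inv _ _ hdom.1 (fun r hr => ?_) (c := c)
      (Subtype.ext (mul_inv_cancel₀ hc0)) hwc hwc' (minpoly R (u ^ N * b)) (minpoly.monic hcR) ?_
    · by_contra hnu
      exact ((hdom.2 r).mpr hnu).ne hr
    · change w ((Polynomial.eval₂ (toLocalRingAbove w R) c _ : localRingAbove w R) : L) < _
      rw [coe_eval₂_toLocalRingAbove, minpoly.aeval, map_zero]
      exact zero_lt_one
  have hu0 : u ≠ 0 := by
    rw [← w.ne_zero_iff, hu]
    exact one_ne_zero
  have hquot : t / b = u ^ N * t * (u ^ N * b)⁻¹ := by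
    rw [← div_eq_mul_inv, mul_div_mul_left _ _ (pow_ne_zero N hu0)]
  have hfactor := (homog_congr (w.comap (algebraMap (localRingAbove w R) L)) hs.le
    (val_mul_le _ (δ := 0) (a := y) (b := c') hwy.le hwc'.le) (add_zero γ).symm
    (Subtype.ext hquot)).trans (homog_mul _ (δ := 0) (a := y) (b := c') hwy.le hwc'.le).symm
  exact (congrArg (grInclusion w R).IsIntegralElem hfactor).mpr (hy.mul _ hc')
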